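/- Let $H$ be the $36\times 36$ matrix with entries $\pm1$ whose rows, written with $1$ for $+1$ and $0$ for $-1$, are $$\begin{array}{ll} 000010011110110101111100011110111010 & 111100011010100010111101100110101101\\ 100001001101101011111000111101110101 & 111000111101000100011110110101011011\\ 110000100011010111110001111011101011 & 110001111010001001001111011010110111\\ 011000010110101110100011111111010110 & 100011111100010010100111101101101110\\ 001100001101011101000111111110101101 & 000111111000100101110011110011011101\\ 100110000010111011001111110101011011 & 001111110001001010011001111110111010\\ 010011000101110110011111100010110111 & 011111100010010100101100111101110101\\ 001001100011101101111111000101101110 & 111111000100101000110110011011101011\\ 000100110111011010111110001011011101 & 111110001001010001111011001111010110\\ 110110101111101100101011101000111000 & 110111010111000111001010010111101100\\ 101101011011110110010111011001110000 & 101110101110001111010100100011110110\\ 011010111001111011101110110011100000 & 011101011100011111101001000001111011\\ 110101110100111101011101101111000000 & 111010110000111111010010001100111101\\ 101011101110011110111011010110000001 & 110101101001111110100100010110011110\\ 010111011011001111110110101100000011 & 101011011011111100001000101011001111\\ 101110110101100111101101011000000111 & 010110111111111000010001010101100111\\ 011101101110110011011010111000001110 & 101101110111110001100010100110110011\\ 111011010111011001110101110000011100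 & 011011101111100011000101001111011001 \end{array}$$ (rows $1$ to $18$ in the left column, rows $19$ to $36$ in the right column). Definitions. A regular Hadamard matrix of order $s$ is an $s\times s$ matrix $K$ with entries $\pm1$, $KK^T=sI$ and constant row sum. An orthogonal array of size $s^2\times N$ on $s$ symbols is an $s^2\times N$ array such that in any two distinct columns every ordered pair of symbols occurs in exactly one row. For a finite field $F$, let $A_F$ be the orthogonal array with rows $(x,y)\in F^2$ and columns $t\in F\cup\{\infty\}$ whose entry is $tx+y$ for $t\in F$ and $x$ for $t=\infty$; a MacNeish array for $s=q_1q_2$, with $q_1,q_2$ prime powers, is the direct product of $N$ chosen columns of $A_{\mathbb F_{q_1}}$ and $N$ chosen columns of $A_{\mathbb F_{q_2}}$ (rows and symbols are pairs), up to the naming of rows and symbols. A symmetric $(v,k,\lambda)$-design consists of $v$ points and $v$ distinct blocks (sets of points) such that every block has $k$ points, every point is in $k$ blocks, any two distinct points are in exactly $\lambda$ common blocks and any two distinct blocks meet in exactly $\lambda$ points. An $LSSD(v,k,\lambda;w)$, $w\ge2$, is a graph $\Gamma$ whose vertex set is partitioned into $w$ fibres $X_1,\dots,X_w$ of size $v$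 such that (i) no edge has both ends in one fibre; (ii) for $i\ne j$ the graph between $X_i$ and $X_j$ is the incidence graph of a symmetric $(v,k,\lambda)$-design; (iii) there are constants $\mu,\nu$ such that, for distinct $h,i,j$ and $a\in X_i$, $b\in X_j$, the number of common neighbours of $a$ and $b$ in $X_h$ is $\mu$ if $a\sim b$ and $\nu$ if $a\not\sim b$. It is optimistic if $(2k-v)(\mu-\nu)>0$. Given an orthogonal array $O$ of size $s^2\times N$ and a Hadamard matrix $K$ of order $s$, for a column $i$ of $O$, a symbol $j$ and $1\le l\le s$ let $M^{i,j,l}\in\{0,\pm1\}^{s^2}$ be the vector that vanishes outside the $s$ rows of $O$ with the symbol $j$ in column $i$ and has the entry $K_{k,l}$ in the $k$-th of these rows, counted from the top. Let $\Gamma(O,K)$ be the graph with the $Ns^2$ vertices $(i,j,l)$ in which $(i,j,l)\sim(i',j',l')$ if and only if $i\ne i'$ and $\langle M^{i,j,l},M^{i',j',l'}\rangle=1$; its fibres are the $N$ sets of vertices with a fixed $i$. Statement. $H$ is a regular Hadamard matrix, and for every $n\ge1$ there is an $LSSD(v,k,\lambda;w)$ with $v=36^{2n}$ and $w=4^n+1$.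 More precisely, for every $n\ge1$ the Kronecker power $H_n=H^{\otimes n}$ is a regular Hadamard matrix of order $36^n$, and there is a MacNeish array $O_n$ for $36^n=4^n\cdot9^n$ which is an orthogonal array of size $36^{2n}\times(4^n+1)$ on $36^n$ symbols and for which $\Gamma(O_n,H_n)$ is an optimistic $LSSD(v,k,\lambda;w)$ with $$v=36^{2n},\qquad k=\tfrac12\left(36^{2n}+36^n\right),\qquad \lambda=\tfrac14\left(36^{2n}+2\cdot36^n\right),\qquad w=4^n+1 .$$ -/

import Mathlib

/-- The incidence relation `I` (`I p b`: the point `p` lies in the block `b`) is that of a symmetric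
2-design with parameters `(v, k, l)`. Distinct blocks are distinct sets of points. -/
structure IsSymmetricDesign {P B : Type*} [Finite P] [Finite B] (I : P → B → Prop)
    (v k l : ℕ) : Prop where
  card_points : Nat.card P = v
  card_blocks : Nat.card B = v
  blocks_distinct : ∀ b b' : B, (∀ p : P, I p b ↔ I p b') → b = b'
  block_size : ∀ b : B, {p : P | I p b}.ncard = k
  point_degree : ∀ p : P, {b : B | I p b}.ncard = k
  points_joint : ∀ p p' : P, p ≠ p' → {b : B | I p b ∧ I p' b}.ncard = l
  blocks_meet : ∀ b b' : B, b ≠ b' → {p : P | I p b ∧ I p b'}.ncard = l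

/-- For `a`, `b` in distinct fibres, both different from the fibre `h`, the number of common
neighbours of `a` and `b` in the fibre `h` is `μ` if `a ∼ b` and `ν` if not. -/
def HasLinkConstants {V : Type*} {w : ℕ} (Γ : SimpleGraph V) (fib : V → Fin w) (μ ν : ℕ) : Prop :=
  ∀ (h : Fin w) (a b : V), fib a ≠ fib b → h ≠ fib a → h ≠ fib b →
    (Γ.Adj a b → {c : V | fib c = h ∧ Γ.Adj a c ∧ Γ.Adj b c}.ncard = μ) ∧
    (¬ Γ.Adj a b → {c : V | fib c = h ∧ Γ.Adj a c ∧ Γ.Adj b c}.ncard = ν)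

/-- `Γ`, with the fibres `{x | fib x = i}` for `i : Fin w`, is a (homogeneous) linked system of
symmetric designs `LSSD(v, k, l; w)`. -/
structure IsLSSD {V : Type*} [Finite V] {w : ℕ} (Γ : SimpleGraph V) (fib : V → Fin w)
    (v k l : ℕ) : Prop where
  two_le : 2 ≤ w
  no_edge : ∀ x y : V, fib x = fib y → ¬ Γ.Adj x y
  design : ∀ i j : Fin w, i ≠ j →
    IsSymmetricDesign (fun (p : {x : V // fib x = i}) (b : {x : V // fib x = j}) =>
      Γ.Adj p.1 b.1) v k l
  linked : ∃ μ ν : ℕ, HasLinkConstants Γ fib μ ν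

/-- A linked system with block size `k` on fibres of size `v` is optimistic if
`(2k - v)(μ - ν) > 0`. -/
def IsOptimistic {V : Type*} {w : ℕ} (Γ : SimpleGraph V) (fib : V → Fin w) (v k : ℕ) : Prop :=
  ∃ μ ν : ℕ, HasLinkConstants Γ fib μ ν ∧
    0 < (2 * (k : ℤ) - (v : ℤ)) * ((μ : ℤ) - (ν : ℤ))

/-- A real Hadamard matrix of order `s` with constant row sum. -/
structure IsRegularHadamard {s : ℕ} (H : Matrix (Fin s) (Fin s) ℤ) : Prop where
  entries : ∀ i j, H i j = 1 ∨ H i j = -1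
  mul_transpose : H * H.transpose = (s : ℤ) • (1 : Matrix (Fin s) (Fin s) ℤ)
  regular : ∃ c : ℤ, ∀ i, ∑ j, H i j = c

/-- The Kronecker power `H ⊗ ⋯ ⊗ H` (`n` factors); an index of the power is read as the string of
its `n` digits in base `m`. -/
def kroneckerPow {m : ℕ} (H : Matrix (Fin m) (Fin m) ℤ) (n : ℕ) :
    Matrix (Fin (m ^ n)) (Fin (m ^ n)) ℤ :=
  fun x y => ∏ i : Fin n, H (finFunctionFinEquiv.symm x i) (finFunctionFinEquiv.symm y i)

/-- The rows of the sign pattern of `hadamard36`: the decimal digits of each number, padded with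
leading zeros to 36 digits and read from left to right, with `1` for `+` and `0` for `-`. -/
def hadamard36Rows : Fin 36 → ℕ :=
  ![000010011110110101111100011110111010,
    100001001101101011111000111101110101,
    110000100011010111110001111011101011,
    011000010110101110100011111111010110,
    001100001101011101000111111110101101,
    100110000010111011001111110101011011,
    010011000101110110011111100010110111,
    001001100011101101111111000101101110,
    000100110111011010111110001011011101,
    110110101111101100101011101000111000,
    101101011011110110010111011001110000,
    011010111001111011101110110011100000,
    110101110100111101011101101111000000,
    101011101110011110111011010110000001,
    010111011011001111110110101100000011,
    101110110101100111101101011000000111,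
    011101101110110011011010111000001110,
    111011010111011001110101110000011100,
    111100011010100010111101100110101101,
    111000111101000100011110110101011011,
    110001111010001001001111011010110111,
    100011111100010010100111101101101110,
    000111111000100101110011110011011101,
    001111110001001010011001111110111010,
    011111100010010100101100111101110101,
    111111000100101000110110011011101011,
    111110001001010001111011001111010110,
    110111010111000111001010010111101100,
    101110101110001111010100100011110110,
    011101011100011111101001000001111011,
    111010110000111111010010001100111101,
    110101101001111110100100010110011110,
    101011011011111100001000101011001111,
    010110111111111000010001010101100111,
    101101110111110001100010100110110011,
    011011101111100011000101001111011001]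

/-- The explicit regular Hadamard matrix of order 36. -/
def hadamard36 : Matrix (Fin 36) (Fin 36) ℤ :=
  fun i j => if hadamard36Rows i / 10 ^ (35 - (j : ℕ)) % 10 = 1 then 1 else -1

/-- An orthogonal array of size `s² × N` on `s` symbols: in any two columns each ordered pair of
symbols occurs in exactly one row. -/
def IsOrthogonalArray {m N s : ℕ} (O : Fin m → Fin N → Fin s) : Prop :=
  m = s ^ 2 ∧ ∀ c c' : Fin N, c ≠ c' → ∀ a b : Fin s, ∃! r : Fin m, O r c = a ∧ O r c' = b

/-- The array with `|F|²` rows `(x, y)` and `|F| + 1` columns over a field `F`: the column `t ∈ F`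
has the entries `t x + y`, and the column at infinity has the entries `x`. -/
def fieldArray {F : Type} [Field F] (r : F × F) : Option F → F
  | none => r.1
  | some t => t * r.1 + r.2

/-- An array obtained by the MacNeish construction for `s = q₁ q₂`: up to the naming of rows and
symbols it is the direct product of arrays over two finite fields, of orders `q₁` and `q₂`, each
restricted to `N` of its columns. -/
def IsMacNeishArray {m N s : ℕ} (q₁ q₂ : ℕ) (O : Fin m → Fin N → Fin s) : Prop :=
  ∃ (F₁ F₂ : Type) (_ : Field F₁) (_ : Field F₂) (ρ : Fin m ≃ (F₁ × F₁) × (F₂ × F₂))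
    (σ : Fin s ≃ F₁ × F₂) (κ₁ : Fin N ↪ Option F₁) (κ₂ : Fin N ↪ Option F₂),
    Nat.card F₁ = q₁ ∧ Nat.card F₂ = q₂ ∧
    ∀ r c, σ (O r c) = (fieldArray (ρ r).1 (κ₁ c), fieldArray (ρ r).2 (κ₂ c))

/-- The vector attached to the column `i` of an array `O`, a symbol `j` and a column `l` of `H`:
it is supported on the rows of `O` that have the symbol `j` in column `i`, and its entry in the
`k`-th of these rows, counted from the top, is `H k l`. -/
def arrayVector {m N s : ℕ} (O : Fin m → Fin N → Fin s) (H : Matrix (Fin s) (Fin s) ℤ)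
    (x : Fin N × Fin s × Fin s) (r : Fin m) : ℤ :=
  if O r x.1 = x.2.1 then
    if hk : (Finset.univ.filter fun r' : Fin m => r' < r ∧ O r' x.1 = x.2.1).card < s then
      H ⟨(Finset.univ.filter fun r' : Fin m => r' < r ∧ O r' x.1 = x.2.1).card, hk⟩ x.2.2
    else 0
  else 0

/-- The graph of an orthogonal array `O` and a Hadamard matrix `H`: the vertices are the vectors
of the bases attached to the columns of `O`, the bases are the fibres, and vectors in different
bases are adjacent if their inner product (which is `1` or `-1`) is `1`. -/
def arrayGraph {m N s : ℕ} (O : Fin m → Fin N → Fin s) (H : Matrix (Fin s) (Fin s) ℤ) :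
    SimpleGraph (Fin N × Fin s × Fin s) where
  Adj x y := x.1 ≠ y.1 ∧ ∑ r, arrayVector O H x r * arrayVector O H y r = 1
  symm := ⟨fun x y h => ⟨h.1.symm, by simpa only [mul_comm] using h.2⟩⟩
  loopless := ⟨fun x h => h.1 rfl⟩

/-! Sorting the rows of an orthogonal array by their symbol in one column turns the matrix of the
vectors attached to that column into the block diagonal matrix `1 ⊗ₖ K`. Hence the columns of the
array give square matrices `B` with `B * Bᵀ = Bᵀ * B = s • 1`, and since `K` is regular, their row
sums agree. Two columns of the array share exactly one row for each pair of symbols, so the inner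
product of vectors from different bases is a product of two entries of `K`, that is `1` or `-1`.

The Gram matrices `G i j = (B i)ᵀ * B j` satisfy `G i h * G h j = s • G i j`, and each row of
`G i j` has sum `s`. For functions `f` and `g` with values `1` and `-1` on a finite set `C`,
`4 * #{c | f c = g c = 1} = #C + ∑ f + ∑ g + ∑ f * g`; applied to two rows of Gram matrices, this
gives all the neighbour counts of a linked system. They are integers because a Hadamard matrix of
order greater than `2` has order divisible by `4`. -/

open Matrix
open scoped Kronecker

section FibreRank

variable {α β : Type*} [Fintype α] [LinearOrder α] [DecidableEq β]

/-- The position of `a` in its fibre under `f`, counted from `0`. It numbers the rows that carry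
the same symbol in a column of an array. -/
def fibreRank (f : α → β) (a : α) : ℕ :=
  (Finset.univ.filter fun b => b < a ∧ f b = f a).card

theorem fibreRank_lt_card (f : α → β) (a : α) :
    fibreRank f a < (Finset.univ.filter fun b => f b = f a).card := by
  refine Finset.card_lt_card <| (Finset.ssubset_iff_of_subset fun b hb => ?_).mpr
    ⟨a, by simp, by simp⟩
  simp only [Finset.mem_filter, Finset.mem_univ, true_and] at hb ⊢
  exact hb.2

theorem fibreRank_lt_fibreRank {f : α → β} {a b : α} (hab : a < b) (hf : f a = f b) :
    fibreRank f a < fibreRank f b := by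
  refine Finset.card_lt_card <| (Finset.ssubset_iff_of_subset fun c hc => ?_).mpr
    ⟨a, by simp [hab, hf], by simp⟩
  simp only [Finset.mem_filter, Finset.mem_univ, true_and] at hc ⊢
  exact ⟨hc.1.trans hab, hc.2.trans hf⟩

theorem eq_of_fibreRank_eq {f : α → β} {a b : α} (hf : f a = f b)
    (hrank : fibreRank f a = fibreRank f b) : a = b := by
  rcases lt_trichotomy a b with hab | hab | hba
  · exact absurd hrank (fibreRank_lt_fibreRank hab hf).ne
  · exact hab
  · exact absurd hrank (fibreRank_lt_fibreRank hba hf.symm).ne'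

end FibreRank

section Counting

theorem four_mul_card_filter_eq_one {C : Type*} [Fintype C] {f g : C → ℤ}
    (hf : ∀ c, f c = 1 ∨ f c = -1) (hg : ∀ c, g c = 1 ∨ g c = -1) :
    4 * ((Finset.univ.filter fun c => f c = 1 ∧ g c = 1).card : ℤ) =
      Fintype.card C + ∑ c, f c + ∑ c, g c + ∑ c, f c * g c := by
  rw [Finset.card_filter, Nat.cast_sum, Finset.mul_sum, ← Finset.card_univ,
    Finset.cast_card, ← Finset.sum_add_distrib, ← Finset.sum_add_distrib,
    ← Finset.sum_add_distrib]
  refine Finset.sum_congr rfl fun c _ => ?_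
  rcases hf c with h | h <;> rcases hg c with h' | h' <;> simp [h, h']

theorem ncard_setOf_fst_eq {ι D : Type*} (i : ι) (p : ι × D → Prop) :
    {x : ι × D | x.1 = i ∧ p x}.ncard = {d : D | p (i, d)}.ncard := by
  rw [← Set.ncard_image_of_injective {d : D | p (i, d)} (Prod.mk_right_injective i)]
  congr 1
  ext ⟨j, d⟩
  simp only [Set.mem_ofPred_eq, Set.mem_image, Prod.mk.injEq]
  grind

theorem ncard_subtype_fst_eq {ι D : Type*} (i : ι) (p : ι × D → Prop) :
    {x : {x : ι × D // x.1 = i} | p x.1}.ncard = {d : D | p (i, d)}.ncard := by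
  rw [← ncard_setOf_fst_eq, ← Set.ncard_image_of_injective _ Subtype.val_injective]
  congr 1
  ext x
  simp [and_comm]

end Counting

section UnbiasedBases

variable {ι R D : Type*} [Fintype R]

/-- The Gram matrix of the union of the bases formed by the columns of the matrices `B i`; the
index `(i, d)` stands for the column `d` of `B i`. -/
def basisGram (B : ι → Matrix R D ℤ) : Matrix (ι × D) (ι × D) ℤ :=
  fun x y => ((B x.1)ᵀ * B y.1) x.2 y.2

/-- The graph on the columns of the matrices `B i` in which columns of different matrices are
adjacent if their inner product is `1`. It is the common form of the graphs `arrayGraph`. -/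
def basisGraph (B : ι → Matrix R D ℤ) : SimpleGraph (ι × D) where
  Adj x y := x.1 ≠ y.1 ∧ basisGram B x y = 1
  symm := ⟨fun x y h => ⟨h.1.symm, by
    simpa only [basisGram, mul_apply, transpose_apply, mul_comm] using h.2⟩⟩
  loopless := ⟨fun _ h => h.1 rfl⟩

/-- The matrices `B i` form a system of mutually unbiased bases with a common sum: the columns of
each `B i` are an orthogonal basis of vectors of squared length `s`, vectors from different bases
have inner product `1` or `-1`, and the sum of the vectors of a basis does not depend on the
basis. -/
structure IsUnbiasedSystem [Fintype D] [DecidableEq R] [DecidableEq D] (B : ι → Matrix R D ℤ)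
    (s : ℕ) : Prop where
  mul_transpose : ∀ i, B i * (B i)ᵀ = (s : ℤ) • (1 : Matrix R R ℤ)
  transpose_mul : ∀ i, (B i)ᵀ * B i = (s : ℤ) • (1 : Matrix D D ℤ)
  mulVec_one : ∀ i j, B i *ᵥ 1 = B j *ᵥ 1
  unbiased : ∀ i j, i ≠ j → ∀ d e, ((B i)ᵀ * B j) d e = 1 ∨ ((B i)ᵀ * B j) d e = -1

namespace IsUnbiasedSystem

variable [Fintype D] [DecidableEq R] [DecidableEq D] {B : ι → Matrix R D ℤ} {s : ℕ}

theorem basisGram_eq_one_or_neg_one (hB : IsUnbiasedSystem B s) {x y : ι × D}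
    (hxy : x.1 ≠ y.1) : basisGram B x y = 1 ∨ basisGram B x y = -1 :=
  hB.unbiased _ _ hxy _ _

theorem basisGram_self (hB : IsUnbiasedSystem B s) (x : ι × D) : basisGram B x x = s := by
  simp [basisGram, hB.transpose_mul]

theorem basisGram_eq_zero (hB : IsUnbiasedSystem B s) {x y : ι × D} (hfst : x.1 = y.1)
    (hne : x ≠ y) : basisGram B x y = 0 := by
  obtain ⟨i, d⟩ := x
  obtain ⟨_, e⟩ := y
  obtain rfl : i = _ := hfst
  have hde : d ≠ e := fun h => hne (by rw [h])
  simp [basisGram, hB.transpose_mul, hde]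

theorem sum_basisGram_mul_basisGram (hB : IsUnbiasedSystem B s) (h : ι) (x y : ι × D) :
    ∑ d, basisGram B x (h, d) * basisGram B y (h, d) = s * basisGram B x y := by
  calc ∑ d, basisGram B x (h, d) * basisGram B y (h, d)
      = ((B x.1)ᵀ * B h * ((B y.1)ᵀ * B h)ᵀ) x.2 y.2 := rfl
    _ = ((B x.1)ᵀ * (B h * (B h)ᵀ) * B y.1) x.2 y.2 := by
        simp only [Matrix.transpose_mul, transpose_transpose, Matrix.mul_assoc]
    _ = s * basisGram B x y := by
        rw [hB.mul_transpose, Matrix.mul_smul, Matrix.mul_one, Matrix.smul_mul]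
        rfl

theorem sum_basisGram (hB : IsUnbiasedSystem B s) (h : ι) (x : ι × D) :
    ∑ d, basisGram B x (h, d) = s := by
  calc ∑ d, basisGram B x (h, d)
      = (((B x.1)ᵀ * B h) *ᵥ 1) x.2 := by simp [mulVec, dotProduct, basisGram]
    _ = (((B x.1)ᵀ * B x.1) *ᵥ 1) x.2 := by
        rw [← mulVec_mulVec, hB.mulVec_one h x.1, mulVec_mulVec]
    _ = s := by simp [hB.transpose_mul]

theorem card_eq_sq (hB : IsUnbiasedSystem B s) {h : ι} {x : ι × D} (hx : x.1 ≠ h) :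
    Fintype.card D = s ^ 2 := by
  have hsq (d : D) : basisGram B x (h, d) * basisGram B x (h, d) = 1 := by
    rcases hB.basisGram_eq_one_or_neg_one (y := (h, d)) hx with hd | hd <;> simp [hd]
  have hsum := hB.sum_basisGram_mul_basisGram h x x
  simp only [hsq, hB.basisGram_self, Finset.sum_const, Finset.card_univ, nsmul_eq_mul,
    mul_one] at hsum
  rw [sq]
  exact_mod_cast hsum

theorem four_mul_ncard_common_neighbors (hB : IsUnbiasedSystem B s) {h : ι} {x y : ι × D}
    (hx : x.1 ≠ h) (hy : y.1 ≠ h) :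
    4 * ({d : D | (basisGraph B).Adj x (h, d) ∧ (basisGraph B).Adj y (h, d)}.ncard : ℤ) =
      s ^ 2 + 2 * s + s * basisGram B x y := by
  have hset : {d : D | (basisGraph B).Adj x (h, d) ∧ (basisGraph B).Adj y (h, d)} =
      (Finset.univ.filter fun d => basisGram B x (h, d) = 1 ∧ basisGram B y (h, d) = 1 :
        Finset D) := by
    ext d
    simp [basisGraph, hx, hy]
  rw [hset, Set.ncard_coe_finset,
    four_mul_card_filter_eq_one (fun d => hB.basisGram_eq_one_or_neg_one (y := (h, d)) hx)
      (fun d => hB.basisGram_eq_one_or_neg_one (y := (h, d)) hy),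
    hB.sum_basisGram, hB.sum_basisGram, hB.sum_basisGram_mul_basisGram, hB.card_eq_sq hx]
  push_cast
  ring

theorem four_mul_ncard_common_neighbors_of_fst_eq (hB : IsUnbiasedSystem B s) {h : ι}
    {x y : ι × D} (hx : x.1 ≠ h) (hfst : x.1 = y.1) (hne : x ≠ y) :
    4 * {d : D | (basisGraph B).Adj x (h, d) ∧ (basisGraph B).Adj y (h, d)}.ncard =
      s ^ 2 + 2 * s := by
  have hcommon := hB.four_mul_ncard_common_neighbors hx (hfst ▸ hx : y.1 ≠ h)
  rw [hB.basisGram_eq_zero hfst hne] at hcommon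
  zify
  linarith

theorem two_mul_ncard_neighbors (hB : IsUnbiasedSystem B s) {h : ι} {x : ι × D}
    (hx : x.1 ≠ h) : 2 * {d : D | (basisGraph B).Adj x (h, d)}.ncard = s ^ 2 + s := by
  have hcommon := hB.four_mul_ncard_common_neighbors hx hx
  simp only [and_self, hB.basisGram_self] at hcommon
  zify
  linarith

theorem isSymmetricDesign_basisGraph [Finite ι] [Nonempty D] (hB : IsUnbiasedSystem B s) {k l : ℕ}
    (hk : 2 * k = s ^ 2 + s) (hl : 4 * l = s ^ 2 + 2 * s) {i j : ι} (hij : i ≠ j) :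
    IsSymmetricDesign (fun (p : {x : ι × D // x.1 = i}) (b : {x : ι × D // x.1 = j}) =>
      (basisGraph B).Adj p.1 b.1) (s ^ 2) k l := by
  have hcardD : Fintype.card D = s ^ 2 := hB.card_eq_sq (x := (i, Classical.arbitrary D)) hij
  have hcard (i : ι) : Nat.card {x : ι × D // x.1 = i} = s ^ 2 := by
    simpa [Set.ncard_univ, hcardD] using ncard_subtype_fst_eq (D := D) i fun _ => True
  have hdeg {i j : ι} (hij : i ≠ j) (p : {x : ι × D // x.1 = i}) :
      {b : {x : ι × D // x.1 = j} | (basisGraph B).Adj p.1 b.1}.ncard = k := by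
    rw [ncard_subtype_fst_eq j fun b => (basisGraph B).Adj p.1 b]
    have := hB.two_mul_ncard_neighbors (h := j) (x := p.1) (by rwa [p.2])
    omega
  have hjoint {i j : ι} (hij : i ≠ j) (p p' : {x : ι × D // x.1 = i}) (hp : p ≠ p') :
      {b : {x : ι × D // x.1 = j} |
        (basisGraph B).Adj p.1 b.1 ∧ (basisGraph B).Adj p'.1 b.1}.ncard = l := by
    rw [ncard_subtype_fst_eq j fun b => (basisGraph B).Adj p.1 b ∧ (basisGraph B).Adj p'.1 b]
    have := hB.four_mul_ncard_common_neighbors_of_fst_eq (h := j) (x := p.1) (y := p'.1)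
      (by rwa [p.2]) (by rw [p.2, p'.2]) (Subtype.coe_injective.ne hp)
    omega
  have hsize (b : {x : ι × D // x.1 = j}) :
      {p : {x : ι × D // x.1 = i} | (basisGraph B).Adj p.1 b.1}.ncard = k := by
    simpa only [(basisGraph B).adj_comm] using hdeg hij.symm b
  have hmeet (b b' : {x : ι × D // x.1 = j}) (hb : b ≠ b') :
      {p : {x : ι × D // x.1 = i} |
        (basisGraph B).Adj p.1 b.1 ∧ (basisGraph B).Adj p.1 b'.1}.ncard = l := by
    simpa only [(basisGraph B).adj_comm] using hjoint hij.symm b b' hb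
  refine ⟨hcard i, hcard j, fun b b' hbb => ?_, hsize, hdeg hij, hjoint hij, hmeet⟩
  by_contra hb
  have hkl : k = l := by simpa only [← hbb, and_self, hsize] using hmeet b b' hb
  have hpos : 0 < s ^ 2 := hcardD ▸ Fintype.card_pos
  omega

theorem hasLinkConstants_basisGraph {N : ℕ} {B : Fin N → Matrix R D ℤ}
    (hB : IsUnbiasedSystem B s) {μ ν : ℕ} (hμ : 4 * μ = s ^ 2 + 3 * s)
    (hν : 4 * ν = s ^ 2 + s) : HasLinkConstants (basisGraph B) Prod.fst μ ν := by
  intro h x y hxy hx hy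
  rw [ncard_setOf_fst_eq h fun c => (basisGraph B).Adj x c ∧ (basisGraph B).Adj y c]
  have hcommon := hB.four_mul_ncard_common_neighbors hx.symm hy.symm
  zify at hμ hν ⊢
  refine ⟨fun hadj => ?_, fun hadj => ?_⟩
  · rw [hadj.2] at hcommon
    linarith
  · rw [(hB.basisGram_eq_one_or_neg_one hxy).resolve_left fun hone => hadj ⟨hxy, hone⟩]
      at hcommon
    linarith

theorem exists_isLSSD_basisGraph [Nonempty D] {N : ℕ} {B : Fin N → Matrix R D ℤ}
    (hB : IsUnbiasedSystem B s) (hN : 2 ≤ N) (hs : 4 ∣ s) :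
    ∃ k l : ℕ, 2 * k = s ^ 2 + s ∧ 4 * l = s ^ 2 + 2 * s ∧
      IsLSSD (basisGraph B) Prod.fst (s ^ 2) k l ∧
      IsOptimistic (basisGraph B) Prod.fst (s ^ 2) k := by
  obtain ⟨t, rfl⟩ := hs
  have hlink : HasLinkConstants (basisGraph B) Prod.fst (4 * t ^ 2 + 3 * t) (4 * t ^ 2 + t) :=
    hB.hasLinkConstants_basisGraph (by ring) (by ring)
  refine ⟨8 * t ^ 2 + 2 * t, 4 * t ^ 2 + 2 * t, by ring, by ring,
    ⟨hN, fun x y hxy hadj => hadj.1 hxy, fun i j hij =>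
      hB.isSymmetricDesign_basisGraph (k := 8 * t ^ 2 + 2 * t) (l := 4 * t ^ 2 + 2 * t)
        (by ring) (by ring) hij, _, _, hlink⟩,
    _, _, hlink, ?_⟩
  have ht : 0 < t := by
    have hcard : Fintype.card D = (4 * t) ^ 2 :=
      hB.card_eq_sq (h := ⟨1, hN⟩) (x := (⟨0, by omega⟩, Classical.arbitrary D)) (by simp)
    have hpos : 0 < (4 * t) ^ 2 := hcard ▸ Fintype.card_pos
    exact Nat.pos_of_ne_zero (by rintro rfl; simp at hpos)
  have hprod : (2 * ((8 * t ^ 2 + 2 * t : ℕ) : ℤ) - ((4 * t) ^ 2 : ℕ)) *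
      ((4 * t ^ 2 + 3 * t : ℕ) - (4 * t ^ 2 + t : ℕ)) = 8 * t ^ 2 := by
    push_cast
    ring
  rw [hprod]
  positivity

end IsUnbiasedSystem

end UnbiasedBases

namespace IsRegularHadamard

variable {s : ℕ} {K : Matrix (Fin s) (Fin s) ℤ}

theorem isHadamard (hK : IsRegularHadamard K) : K.IsHadamard := by
  rcases eq_or_ne s 0 with rfl | hs
  · exact ⟨fun i => i.elim0, Subsingleton.elim _ _, Subsingleton.elim _ _⟩
  · refine .of_mul_conjTranspose
      (fun i j => Unitary.mem_iff_eq_one_or_eq_neg_one.mpr (hK.entries i j)) ?_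
      (IsRegular.of_ne_zero (by simpa using hs))
    simpa [conjTranspose_eq_transpose_of_trivial] using hK.mul_transpose

theorem transpose_mul (hK : IsRegularHadamard K) :
    Kᵀ * K = (s : ℤ) • (1 : Matrix (Fin s) (Fin s) ℤ) := by
  simpa [conjTranspose_eq_transpose_of_trivial] using hK.isHadamard.conjTranspose_mul

theorem four_dvd (hK : IsRegularHadamard K) (hs : 2 < s) : 4 ∣ s := by
  simpa using hK.isHadamard.four_dvd_card (by simpa using hs)

end IsRegularHadamard

section OrthogonalArray

variable {m N s : ℕ} {O : Fin m → Fin N → Fin s}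

/-- The matrix whose columns are the vectors that `arrayVector` attaches to the column `i` of the
array `O`. -/
def arrayBasis (O : Fin m → Fin N → Fin s) (K : Matrix (Fin s) (Fin s) ℤ) (i : Fin N) :
    Matrix (Fin m) (Fin s × Fin s) ℤ :=
  fun r d => arrayVector O K (i, d) r

theorem arrayGraph_eq_basisGraph (O : Fin m → Fin N → Fin s) (K : Matrix (Fin s) (Fin s) ℤ) :
    arrayGraph O K = basisGraph (arrayBasis O K) := rfl

namespace IsOrthogonalArray

theorem card_filter_le (hO : IsOrthogonalArray O) {i i' : Fin N} (hi : i ≠ i') (j : Fin s) :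
    (Finset.univ.filter fun r => O r i = j).card ≤ s := by
  have hinj : Set.InjOn (fun r => O r i') (Finset.univ.filter fun r => O r i = j) := by
    intro r hr r' hr' h
    simp only [Finset.coe_filter, Finset.mem_univ, true_and, Set.mem_ofPred_eq] at hr hr'
    exact (hO.2 i i' hi j (O r i')).unique ⟨hr, rfl⟩ ⟨hr', h.symm⟩
  simpa using Finset.card_le_card_of_injOn (t := Finset.univ) _ (fun _ _ => by simp) hinj

theorem exists_arrayBasis_eq_submatrix (hO : IsOrthogonalArray O) {i i' : Fin N}
    (hi : i ≠ i') : ∃ φ : Fin m ≃ Fin s × Fin s, (∀ r, (φ r).1 = O r i) ∧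
      ∀ K : Matrix (Fin s) (Fin s) ℤ, arrayBasis O K i =
        ((1 : Matrix (Fin s) (Fin s) ℤ) ⊗ₖ K).submatrix φ (Equiv.refl _) := by
  have hrank (r : Fin m) : fibreRank (O · i) r < s :=
    (fibreRank_lt_card (O · i) r).trans_le (hO.card_filter_le hi (O r i))
  let f (r : Fin m) : Fin s × Fin s := (O r i, ⟨fibreRank (O · i) r, hrank r⟩)
  have hinj : f.Injective := fun r r' h => by
    simp only [f, Prod.mk.injEq, Fin.mk.injEq] at h
    exact eq_of_fibreRank_eq (f := (O · i)) h.1 h.2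
  have hbij : f.Bijective :=
    (Fintype.bijective_iff_injective_and_card f).mpr ⟨hinj, by simp [hO.1, sq]⟩
  refine ⟨Equiv.ofBijective f hbij, fun r => rfl, fun K => ?_⟩
  ext r ⟨j, l⟩
  by_cases hj : O r i = j
  · subst hj
    have hlt : (Finset.univ.filter fun r' => r' < r ∧ O r' i = O r i).card < s := hrank r
    simp [arrayBasis, arrayVector, f, fibreRank, hlt]
  · simp [arrayBasis, arrayVector, f, hj]

variable {K : Matrix (Fin s) (Fin s) ℤ}

theorem arrayBasis_unbiased (hO : IsOrthogonalArray O) (hK : IsRegularHadamard K)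
    {i i' : Fin N} (hi : i ≠ i') (d e : Fin s × Fin s) :
    ((arrayBasis O K i)ᵀ * arrayBasis O K i') d e = 1 ∨
      ((arrayBasis O K i)ᵀ * arrayBasis O K i') d e = -1 := by
  obtain ⟨φ, hφ, hφK⟩ := hO.exists_arrayBasis_eq_submatrix hi
  obtain ⟨ψ, hψ, hψK⟩ := hO.exists_arrayBasis_eq_submatrix hi.symm
  obtain ⟨r, ⟨hrd, hre⟩, huniq⟩ := hO.2 i i' hi d.1 e.1
  have hsum : ((arrayBasis O K i)ᵀ * arrayBasis O K i') d e = K (φ r).2 d.2 * K (ψ r).2 e.2 := by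
    rw [mul_apply, Finset.sum_eq_single r]
    · simp [hφK, hψK, hφ, hψ, hrd, hre, one_apply]
    · intro q _ hq
      have : ¬(O q i = d.1 ∧ O q i' = e.1) := fun h => hq (huniq q h)
      simp only [hφK, hψK, hφ, hψ, transpose_apply, submatrix_apply, kroneckerMap_apply, one_apply]
      grind
    · simp
  rw [hsum]
  rcases hK.entries (φ r).2 d.2 with h | h <;> rcases hK.entries (ψ r).2 e.2 with h' | h' <;>
    simp [h, h']

theorem isUnbiasedSystem_arrayBasis (hO : IsOrthogonalArray O) (hN : 2 ≤ N)
    (hK : IsRegularHadamard K) : IsUnbiasedSystem (arrayBasis O K) s := by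
  have : Nontrivial (Fin N) := Fin.nontrivial_iff_two_le.mpr hN
  have hblock (i : Fin N) : ∃ φ : Fin m ≃ Fin s × Fin s, arrayBasis O K i =
      ((1 : Matrix (Fin s) (Fin s) ℤ) ⊗ₖ K).submatrix φ (Equiv.refl _) := by
    obtain ⟨i', hi'⟩ := exists_ne i
    obtain ⟨φ, -, hφ⟩ := hO.exists_arrayBasis_eq_submatrix hi'.symm
    exact ⟨φ, hφ K⟩
  obtain ⟨c, hc⟩ := hK.regular
  have hsum (i : Fin N) : arrayBasis O K i *ᵥ 1 = fun _ => c := by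
    obtain ⟨φ, hφ⟩ := hblock i
    ext r
    simp [hφ, mulVec, dotProduct, Fintype.sum_prod_type, one_apply, hc]
  refine ⟨fun i => ?_, fun i => ?_, fun i j => (hsum i).trans (hsum j).symm,
    fun i j hij => hO.arrayBasis_unbiased hK hij⟩ <;> obtain ⟨φ, hφ⟩ := hblock i
  · rw [hφ, transpose_submatrix, submatrix_mul_equiv, ← kroneckerMap_transpose,
      ← mul_kronecker_mul, hK.mul_transpose,
      transpose_one, Matrix.one_mul, kronecker_smul, one_kronecker_one, submatrix_smul,
      Pi.smul_apply, Pi.smul_apply, submatrix_one_equiv]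
  · rw [hφ, transpose_submatrix, submatrix_mul_equiv, ← kroneckerMap_transpose,
      ← mul_kronecker_mul, hK.transpose_mul,
      transpose_one, Matrix.one_mul, kronecker_smul, one_kronecker_one, submatrix_smul,
      Pi.smul_apply, Pi.smul_apply, submatrix_one_equiv]

theorem exists_isLSSD_arrayGraph (hO : IsOrthogonalArray O) (hN : 2 ≤ N)
    (hK : IsRegularHadamard K) (hs : 2 < s) :
    ∃ k l : ℕ, 2 * k = m + s ∧ 4 * l = m + 2 * s ∧
      IsLSSD (arrayGraph O K) Prod.fst m k l ∧ IsOptimistic (arrayGraph O K) Prod.fst m k := by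
  obtain rfl := hO.1
  have : NeZero s := ⟨by omega⟩
  rw [arrayGraph_eq_basisGraph]
  exact (hO.isUnbiasedSystem_arrayBasis hN hK).exists_isLSSD_basisGraph hN (hK.four_dvd hs)

end IsOrthogonalArray

end OrthogonalArray

section MacNeish

theorem existsUnique_fieldArray {F : Type} [Field F] {t t' : Option F} (htt' : t ≠ t') (a b : F) :
    ∃! r : F × F, fieldArray r t = a ∧ fieldArray r t' = b := by
  rcases t with _ | t <;> rcases t' with _ | t'
  · exact absurd rfl htt'
  · refine ⟨(a, b - t' * a), by simp [fieldArray], ?_⟩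
    rintro ⟨x, y⟩ ⟨rfl, rfl⟩
    simp [fieldArray]
  · refine ⟨(b, a - t * b), by simp [fieldArray], ?_⟩
    rintro ⟨x, y⟩ ⟨rfl, rfl⟩
    simp [fieldArray]
  · have ht : t - t' ≠ 0 := sub_ne_zero.mpr (ne_of_apply_ne some htt')
    refine ⟨((a - b) / (t - t'), (t * b - t' * a) / (t - t')), ?_, ?_⟩
    · constructor <;> simp only [fieldArray] <;> field_simp <;> ring
    · rintro ⟨x, y⟩ ⟨rfl, rfl⟩
      simp only [fieldArray, Prod.mk.injEq, eq_div_iff ht]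
      constructor <;> ring

theorem IsMacNeishArray.isOrthogonalArray {m N s q₁ q₂ : ℕ} {O : Fin m → Fin N → Fin s}
    (hO : IsMacNeishArray q₁ q₂ O) (hm : m = s ^ 2) : IsOrthogonalArray O := by
  obtain ⟨F₁, F₂, _, _, ρ, σ, κ₁, κ₂, -, -, hentry⟩ := hO
  refine ⟨hm, fun c c' hc a b => ?_⟩
  obtain ⟨r₁, hr₁, huniq₁⟩ := existsUnique_fieldArray (κ₁.injective.ne hc) (σ a).1 (σ b).1
  obtain ⟨r₂, hr₂, huniq₂⟩ := existsUnique_fieldArray (κ₂.injective.ne hc) (σ a).2 (σ b).2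
  refine ⟨ρ.symm (r₁, r₂), ⟨σ.injective ?_, σ.injective ?_⟩, ?_⟩
  · rw [hentry, Equiv.apply_symm_apply, hr₁.1, hr₂.1]
  · rw [hentry, Equiv.apply_symm_apply, hr₁.2, hr₂.2]
  · rintro r ⟨rfl, rfl⟩
    rw [Equiv.eq_symm_apply]
    exact Prod.ext (huniq₁ _ (by simp [hentry])) (huniq₂ _ (by simp [hentry]))

theorem exists_isMacNeishArray {q₁ q₂ m N s : ℕ} (hq₁ : IsPrimePow q₁) (hq₂ : IsPrimePow q₂)
    (hN₁ : N ≤ q₁ + 1) (hN₂ : N ≤ q₂ + 1) (hs : s = q₁ * q₂) (hm : m = s ^ 2) :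
    ∃ O : Fin m → Fin N → Fin s, IsMacNeishArray q₁ q₂ O := by
  obtain ⟨field₁⟩ : Nonempty (Field (Fin q₁)) := Fintype.nonempty_field_iff.mpr (by simpa using hq₁)
  obtain ⟨field₂⟩ : Nonempty (Field (Fin q₂)) := Fintype.nonempty_field_iff.mpr (by simpa using hq₂)
  obtain ⟨ρ⟩ : Nonempty (Fin m ≃ (Fin q₁ × Fin q₁) × (Fin q₂ × Fin q₂)) :=
    Fintype.card_eq.mp (by
      simp only [Fintype.card_fin, Fintype.card_prod, hm, hs]
      ring)
  obtain ⟨κ₁⟩ : Nonempty (Fin N ↪ Option (Fin q₁)) :=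
    Function.Embedding.nonempty_of_card_le (by simpa using hN₁)
  obtain ⟨κ₂⟩ : Nonempty (Fin N ↪ Option (Fin q₂)) :=
    Function.Embedding.nonempty_of_card_le (by simpa using hN₂)
  let σ : Fin s ≃ Fin q₁ × Fin q₂ := (finCongr hs).trans finProdFinEquiv.symm
  exact ⟨fun r c => σ.symm (fieldArray (ρ r).1 (κ₁ c), fieldArray (ρ r).2 (κ₂ c)),
    Fin q₁, Fin q₂, field₁, field₂, ρ, σ, κ₁, κ₂, Nat.card_fin _, Nat.card_fin _,
    fun r c => σ.apply_symm_apply _⟩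

end MacNeish

section KroneckerPower

theorem sum_prod_digits {A : Type*} [CommSemiring A] {m n : ℕ} (f : Fin n → Fin m → A) :
    ∑ z : Fin (m ^ n), ∏ i, f i (finFunctionFinEquiv.symm z i) = ∏ i, ∑ a, f i a :=
  (finFunctionFinEquiv.symm.sum_comp fun z : Fin n → Fin m => ∏ i, f i (z i)).trans
    (Fintype.prod_sum f).symm

theorem kroneckerPow_mul_transpose {m : ℕ} {H : Matrix (Fin m) (Fin m) ℤ} {a : ℤ}
    (hH : H * Hᵀ = a • (1 : Matrix (Fin m) (Fin m) ℤ)) (n : ℕ) :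
    kroneckerPow H n * (kroneckerPow H n)ᵀ =
      a ^ n • (1 : Matrix (Fin (m ^ n)) (Fin (m ^ n)) ℤ) := by
  ext x y
  calc (kroneckerPow H n * (kroneckerPow H n)ᵀ) x y
      = ∏ i, (H * Hᵀ) (finFunctionFinEquiv.symm x i) (finFunctionFinEquiv.symm y i) := by
        simp only [mul_apply, transpose_apply, kroneckerPow, ← Finset.prod_mul_distrib]
        rw [← sum_prod_digits]
    _ = (a ^ n • (1 : Matrix (Fin (m ^ n)) (Fin (m ^ n)) ℤ)) x y := by
        simp [hH, one_apply, Finset.prod_ite_zero, ← funext_iff]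

theorem IsRegularHadamard.kroneckerPow {m : ℕ} {H : Matrix (Fin m) (Fin m) ℤ}
    (hH : IsRegularHadamard H) (n : ℕ) : IsRegularHadamard (kroneckerPow H n) where
  entries x y := by
    simp only [← Int.isUnit_iff, _root_.kroneckerPow, IsUnit.prod_univ_iff]
    exact fun i => Int.isUnit_iff.mpr (hH.entries _ _)
  mul_transpose := by
    rw [kroneckerPow_mul_transpose hH.mul_transpose, Nat.cast_pow]
  regular := by
    obtain ⟨c, hc⟩ := hH.regular
    refine ⟨c ^ n, fun x => ?_⟩
    simp only [_root_.kroneckerPow]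
    rw [sum_prod_digits fun i => H (finFunctionFinEquiv.symm x i)]
    simp [hc]

end KroneckerPower

section Hadamard36

theorem mul_transpose_eq_smul_one_of_orthogonal {m R : Type*} [Fintype m] [LinearOrder m]
    [CommRing R] {K : Matrix m m R} (hK : ∀ i j, K i j = 1 ∨ K i j = -1)
    (horth : ∀ i j, i < j → ∑ k, K i k * K j k = 0) :
    K * Kᵀ = (Fintype.card m : R) • (1 : Matrix m m R) := by
  have hself (i k : m) : K i k * K i k = 1 := by
    rcases hK i k with h | h <;> simp [h]
  ext i j
  simp only [mul_apply, transpose_apply, Matrix.smul_apply, one_apply]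
  rcases lt_trichotomy i j with hij | rfl | hji
  · simp [horth i j hij, hij.ne]
  · simp [hself]
  · simp [mul_comm (K i _), horth j i hji, hji.ne']

theorem isRegularHadamard_hadamard36 : IsRegularHadamard hadamard36 where
  entries i j := ite_eq_or_eq _ _ _
  mul_transpose := mul_transpose_eq_smul_one_of_orthogonal (fun i j => ite_eq_or_eq _ _ _)
    (by decide +kernel)
  regular := ⟨6, by decide +kernel⟩

end Hadamard36

theorem mainTheorem5 (n : ℕ) (hn : 1 ≤ n) :
    IsRegularHadamard hadamard36 ∧
    IsRegularHadamard (kroneckerPow hadamard36 n) ∧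
    ∃ O : Fin (36 ^ (2 * n)) → Fin (4 ^ n + 1) → Fin (36 ^ n),
      IsOrthogonalArray O ∧ IsMacNeishArray (4 ^ n) (9 ^ n) O ∧
      ∃ k l : ℕ, 2 * k = 36 ^ (2 * n) + 36 ^ n ∧ 4 * l = 36 ^ (2 * n) + 2 * 36 ^ n ∧
        IsLSSD (arrayGraph O (kroneckerPow hadamard36 n)) Prod.fst (36 ^ (2 * n)) k l ∧
        IsOptimistic (arrayGraph O (kroneckerPow hadamard36 n)) Prod.fst (36 ^ (2 * n)) k := by
  have hK := isRegularHadamard_hadamard36.kroneckerPow n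
  have hm : 36 ^ (2 * n) = (36 ^ n) ^ 2 := pow_mul' 36 2 n
  have hs : 36 ^ n = 4 ^ n * 9 ^ n := Nat.mul_pow 4 9 n
  have hs_gt : 2 < 36 ^ n :=
    calc 2 < 36 ^ 1 := by norm_num
      _ ≤ 36 ^ n := Nat.pow_le_pow_right (by norm_num) hn
  have h4 : IsPrimePow (4 ^ n) := (Nat.prime_two.isPrimePow.pow two_ne_zero).pow (by omega)
  have h9 : IsPrimePow (9 ^ n) := (Nat.prime_three.isPrimePow.pow two_ne_zero).pow (by omega)
  have h49 : 4 ^ n ≤ 9 ^ n := Nat.pow_le_pow_left (by norm_num) n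
  obtain ⟨O, hO⟩ := exists_isMacNeishArray (N := 4 ^ n + 1) h4 h9 le_rfl (by omega) hs hm
  have hOA := hO.isOrthogonalArray hm
  have hN : 2 ≤ 4 ^ n + 1 := Nat.succ_le_succ (Nat.one_le_pow _ _ (by norm_num))
  exact ⟨isRegularHadamard_hadamard36, hK, O, hOA, hO, hOA.exists_isLSSD_arrayGraph hN hK hs_gt⟩
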